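/- **Proposition.** Let $q$ be a power of a prime, let $K$ be a field extension of $\mathbb F_q(t)$, let $r\ge 1$ be an integer, and let $g_1,\dots,g_{r-1}\in K[z]$; put $g_0:=t$. Let $\Phi$ be the family of Drinfeld $\mathbb F_q[t]$-modules given by $$\Phi_t(x)=tx+\sum_{i=1}^{r-1}g_i(z)\,x^{q^i}+x^{q^r}.$$ Let $\mathbf c\in K[z]$ satisfy $$\deg(\mathbf c)>\max_{0\le i\le r-1}\frac{\deg(g_i)}{q^r-q^i},$$ and put $f_{\mathbf c,n}(z):=\Phi_{t^n}(\mathbf c)\in K[z]$ for $n\ge 0$. Let $v$ be a place of $K$, i.e. a nontrivial absolute value $|\cdot|_v$ on $K$ (necessarily non-archimedean), and let $\mathbb C_v$ be the completion of an algebraic closure of the completion of $K$ at $v$. Let $\mathbb A^1_{\mathrm{Berk},\mathbb C_v}$ be the Berkovich affine line, i.e. the set of multiplicative seminorms $f\mapsto[f]_\lambda$ on $\mathbb C_v[T]$ extending $|\cdot|_v$, with the weakest topology for which $\lambda\mapsto [f]_\lambda$ is continuous for every $f\in\mathbb C_v[T]$. Then the generalized Mandelbrot set $$M_{\mathbf c,v}:=\Bigl\{\lambda\in\mathbb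 A^1_{\mathrm{Berk},\mathbb C_v} : \sup_{n}\,[f_{\mathbf c,n}(T)]_\lambda<\infty\Bigr\}$$ is a compact subset of $\mathbb A^1_{\mathrm{Berk},\mathbb C_v}$. -/

import Mathlib

open Polynomial

noncomputable section

namespace DrinfeldMandelbrot

/-! ### Places of a field and the field `ℂ_v` -/

/-- A place of `K`, given by a nontrivial non-archimedean absolute value on `K`. (In positive
characteristic every absolute value is non-archimedean.) -/
structure Place (K : Type*) [Field K] where
  /-- the absolute value `|·|_v` -/
  abv : AbsoluteValue K ℝ
  nontrivial : abv.IsNontrivial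
  nonarch : IsNonarchimedean abv

variable {K : Type*} [Field K]

/-- The completion `K_v` of `K` at `v`. -/
abbrev Kv (v : Place K) : Type _ := v.abv.Completion

instance (v : Place K) : IsUltrametricDist (Kv v) := by
  apply IsUltrametricDist.isUltrametricDist_of_forall_norm_add_le_max_norm
  intro x y
  induction x, y using UniformSpace.Completion.induction_on₂ with
  | hp =>
    exact isClosed_le (continuous_norm.comp continuous_add)
      ((continuous_norm.comp continuous_fst).max (continuous_norm.comp continuous_snd))
  | ih a b =>
    rw [← UniformSpace.Completion.coe_add, UniformSpace.Completion.norm_coe,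
      UniformSpace.Completion.norm_coe, UniformSpace.Completion.norm_coe]
    exact v.nonarch a.ofAbs b.ofAbs

instance (v : Place K) : NontriviallyNormedField (Kv v) where
  non_trivial := by
    obtain ⟨x, h⟩ := v.nontrivial.exists_abv_gt_one
    exact ⟨(WithAbs.toAbs v.abv x : v.abv.Completion),
      by rw [UniformSpace.Completion.norm_coe]; exact h⟩

/-- An algebraic closure of `K_v`. -/
abbrev KvAlgCl (v : Place K) : Type _ := AlgebraicClosure (Kv v)

/-- `KvAlgCl v` is normed by the unique extension of `|·|_v`. -/
instance (v : Place K) : NormedField (KvAlgCl v) := spectralNorm.normedField (Kv v) (KvAlgCl v)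

/-- `ℂ_v`, the completion of an algebraic closure of the completion of `K` at `v`, with the norm
extending `|·|_v`. -/
abbrev Cv (v : Place K) : Type _ := UniformSpace.Completion (KvAlgCl v)

/-- The canonical embedding `K → K_v → KvAlgCl v → ℂ_v`. -/
def toCv (v : Place K) : K →+* Cv v :=
  (UniformSpace.Completion.coeRingHom (α := KvAlgCl v)).comp
    ((algebraMap (Kv v) (KvAlgCl v)).comp
      ((UniformSpace.Completion.coeRingHom (α := WithAbs v.abv)).comp
        (WithAbs.equiv v.abv).symm.toRingHom))

theorem norm_toCv (v : Place K) (x : K) : ‖toCv v x‖ = v.abv x := by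
  change ‖((algebraMap (Kv v) (KvAlgCl v) ((WithAbs.toAbs v.abv x : WithAbs v.abv) : Kv v) :
    KvAlgCl v) : Cv v)‖ = _
  rw [UniformSpace.Completion.norm_coe]
  exact (spectralNorm_extends _).trans (UniformSpace.Completion.norm_coe _)

/-! ### The Berkovich affine line -/

/-- The Berkovich affine line over a normed field `F`: the multiplicative seminorms on `F[T]`
extending the absolute value of `F`. -/
def BerkovichLine (F : Type*) [NormedField F] : Type _ :=
  {s : MulRingSeminorm F[X] // ∀ a : F, s (C a) = ‖a‖}

/-- The weakest topology such that `x ↦ [f]_x` is continuous for every `f ∈ F[T]`. -/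
instance (F : Type*) [NormedField F] : TopologicalSpace (BerkovichLine F) :=
  ⨅ f : F[X], TopologicalSpace.induced (fun x : BerkovichLine F => x.1 f) inferInstance

/-! ### Drinfeld modules over `K[z]` and generalized Mandelbrot sets -/

section Drinfeld

variable (Fq : Type*) [Field Fq] [Fintype Fq] [Algebra Fq K]

/-- The `F_q`-linear map `x ↦ ∑_{i<r} g_i x^{q^i} + x^{q^r}` on `K[z]`, where `q = #F_q`,
as a polynomial in the `q`-power Frobenius. -/
def drinfeldT (r : ℕ) (g : ℕ → K[X]) : Module.End Fq K[X] :=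
  ∑ i ∈ Finset.range r,
      LinearMap.mulLeft Fq (g i) * (FiniteField.frobeniusAlgHom Fq K[X]).toLinearMap ^ i
    + (FiniteField.frobeniusAlgHom Fq K[X]).toLinearMap ^ r

/-- The Drinfeld module `a ↦ Φ_a`: the `F_q`-algebra homomorphism from `F_q[t]` with
`Φ_t(x) = ∑_{i<r} g_i x^{q^i} + x^{q^r}`, acting on the points `x ∈ K[z]`. -/
def drinfeld (r : ℕ) (g : ℕ → K[X]) : Fq[X] →ₐ[Fq] Module.End Fq K[X] :=
  aeval (drinfeldT Fq r g)

theorem drinfeld_X_apply (r : ℕ) (g : ℕ → K[X]) (x : K[X]) :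
    drinfeld Fq r g X x =
      ∑ i ∈ Finset.range r, g i * x ^ (Fintype.card Fq ^ i) + x ^ (Fintype.card Fq ^ r) := by
  have h : ∀ i : ℕ, ((FiniteField.frobeniusAlgHom Fq K[X]).toLinearMap ^ i) x =
      x ^ (Fintype.card Fq ^ i) := by
    intro i
    induction i with
    | zero => simp
    | succ i ih =>
      rw [pow_succ', Module.End.mul_apply, ih]
      simp [← pow_mul, pow_succ]
  simp [drinfeld, drinfeldT, h]

/-- `f_{c,n} = Φ_{t^n}(c) ∈ K[z]`. -/
def orbitPoly (r : ℕ) (g : ℕ → K[X]) (c : K[X]) (n : ℕ) : K[X] :=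
  drinfeld Fq r g (X ^ n) c

/-- The generalized Mandelbrot set `M_{c,v} = {x : sup_n [f_{c,n}(T)]_x < ∞}` in the Berkovich
affine line over `ℂ_v`. -/
def mandelbrot (v : Place K) (r : ℕ) (g : ℕ → K[X]) (c : K[X]) : Set (BerkovichLine (Cv v)) :=
  {x | BddAbove (Set.range fun n : ℕ => x.1 ((orbitPoly Fq r g c n).map (toCv v)))}

end Drinfeld

end DrinfeldMandelbrot

end

open Polynomial

noncomputable section

namespace DrinfeldMandelbrot

/-! ### Estimates at a point of the Berkovich line, and compactness of discs -/

namespace BerkovichLine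

variable {F : Type*} [NormedField F]

/-! The recursion $f_{n+1}=\sum_{i<r} g_i f_n^{q^i}+f_n^{q^r}$ has an escape region at each point
$\lambda$: if $[f_n]_\lambda>4$ and the top term exceeds twice the sum of the others, then every
later step at least doubles the seminorm (`Escapes.two_mul_le`, `Escapes.mono`). Conversely an
unbounded orbit enters this region. Hence the complement of the Mandelbrot set is a union over $n$
of open conditions, and the set is closed.

The degree hypothesis puts $\mathbf c$ itself in the escape region once $[T]_\lambda$ is large
(`exists_escapes_of_lt`). So the set lies in a closed disc, which is compact by Tychonoff
(`isCompact_disc`). -/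

theorem isInducing_eval :
    Topology.IsInducing (fun (x : BerkovichLine F) (f : F[X]) => x.1 f) := by
  refine ⟨?_⟩
  simp only [Pi.topologicalSpace, induced_iInf, induced_compose]
  rfl

theorem continuous_eval (f : F[X]) : Continuous fun x : BerkovichLine F => x.1 f :=
  (continuous_apply f).comp isInducing_eval.continuous

theorem nonneg (x : BerkovichLine F) (f : F[X]) : 0 ≤ x.1 f := apply_nonneg x.1 f

theorem apply_pow (x : BerkovichLine F) (f : F[X]) (n : ℕ) : x.1 (f ^ n) = x.1 f ^ n :=
  map_pow x.1 f n

theorem apply_sum_le (x : BerkovichLine F) {ι : Type*} (s : Finset ι) (f : ι → F[X]) :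
    x.1 (∑ i ∈ s, f i) ≤ ∑ i ∈ s, x.1 (f i) :=
  Finset.le_sum_of_subadditive x.1 (map_zero x.1).le (map_add_le_add x.1) s f

theorem apply_monomial (x : BerkovichLine F) (n : ℕ) (a : F) :
    x.1 (C a * X ^ n) = ‖a‖ * x.1 X ^ n := by
  rw [map_mul, x.2, apply_pow]

/-- The coefficientwise norm of a polynomial. -/
def normPoly (p : F[X]) : ℝ[X] := ∑ j ∈ Finset.range (p.natDegree + 1), C ‖p.coeff j‖ * X ^ j

theorem natDegree_normPoly_le (p : F[X]) : (normPoly p).natDegree ≤ p.natDegree :=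
  natDegree_sum_le_of_forall_le _ _ fun j hj =>
    (natDegree_C_mul_X_pow_le _ _).trans (by simpa [Nat.lt_succ_iff] using hj)

theorem eval_normPoly (p : F[X]) (ρ : ℝ) :
    (normPoly p).eval ρ = ∑ j ∈ Finset.range (p.natDegree + 1), ‖p.coeff j‖ * ρ ^ j := by
  simp [normPoly, eval_finsetSum]

theorem eval_normPoly_mono (p : F[X]) {ρ σ : ℝ} (hρ : 0 ≤ ρ) (h : ρ ≤ σ) :
    (normPoly p).eval ρ ≤ (normPoly p).eval σ := by
  rw [eval_normPoly, eval_normPoly]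
  gcongr

theorem le_eval_normPoly (x : BerkovichLine F) (p : F[X]) :
    x.1 p ≤ (normPoly p).eval (x.1 X) := by
  conv_lhs => rw [p.as_sum_range_C_mul_X_pow]
  rw [eval_normPoly]
  exact (x.apply_sum_le _ _).trans_eq (Finset.sum_congr rfl fun j _ => x.apply_monomial j _)

/-- The real polynomial whose value at `x(T)` bounds `x(p)` from below by its leading term. -/
def lowerPoly (p : F[X]) : ℝ[X] :=
  C ‖p.leadingCoeff‖ * X ^ p.natDegree - normPoly p.eraseLead

theorem eval_lowerPoly_le (x : BerkovichLine F) (p : F[X]) :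
    (lowerPoly p).eval (x.1 X) ≤ x.1 p := by
  have h1 : x.1 (C p.leadingCoeff * X ^ p.natDegree) ≤ x.1 p + x.1 p.eraseLead := by
    have h := map_sub_le_add x.1 p p.eraseLead
    rwa [show p - p.eraseLead = C p.leadingCoeff * X ^ p.natDegree from
      sub_eq_of_eq_add' p.eraseLead_add_C_mul_X_pow.symm] at h
  rw [apply_monomial] at h1
  have h2 := x.le_eval_normPoly p.eraseLead
  simp only [lowerPoly, eval_sub, eval_mul, eval_C, eval_pow, eval_X]
  linarith

theorem degree_lowerPoly {p : F[X]} (hp : 0 < p.natDegree) :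
    (lowerPoly p).degree = p.natDegree ∧ (lowerPoly p).leadingCoeff = ‖p.leadingCoeff‖ := by
  have hp0 : p ≠ 0 := by rintro rfl; simp at hp
  have hn : ‖p.leadingCoeff‖ ≠ 0 := by simpa using hp0
  have h1 : (C ‖p.leadingCoeff‖ * X ^ p.natDegree : ℝ[X]).degree = p.natDegree :=
    degree_C_mul_X_pow _ hn
  have h2 : (normPoly p.eraseLead).degree < (C ‖p.leadingCoeff‖ * X ^ p.natDegree : ℝ[X]).degree := by
    rw [h1]
    refine degree_le_natDegree.trans_lt (Nat.cast_lt.2 ?_)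
    have := natDegree_normPoly_le p.eraseLead
    have := p.eraseLead_natDegree_le
    omega
  exact ⟨(degree_sub_eq_left_of_degree_lt h2).trans h1, by
    rw [lowerPoly, leadingCoeff_sub_of_degree_lt h2, leadingCoeff_C_mul_X_pow]⟩

/-- Closed discs of the Berkovich affine line are compact. -/
theorem isCompact_disc (R : ℝ) : IsCompact {x : BerkovichLine F | x.1 X ≤ R} := by
  rw [isInducing_eval.isCompact_iff]
  -- On the disc each $[f]$ is bounded by a constant depending only on $f$ and $R$, so the disc
  -- embeds in a product of compact intervals.
  have hK : IsCompact (Set.univ.pi fun f : F[X] => Set.Icc 0 ((normPoly f).eval (max R 0))) :=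
    isCompact_univ_pi fun _ => isCompact_Icc
  refine hK.of_isClosed_subset ?_ ?_
  -- The seminorm axioms are closed conditions on finitely many coordinates each, so the image is
  -- closed in the product.
  · have himage : ((fun (x : BerkovichLine F) (f : F[X]) => x.1 f) '' {x | x.1 X ≤ R}) =
        {s : F[X] → ℝ | (∀ a, s (C a) = ‖a‖) ∧ (∀ f g, s (f + g) ≤ s f + s g) ∧
          (∀ f g, s (f * g) = s f * s g) ∧ s X ≤ R} := by
      ext s
      constructor
      · rintro ⟨x, hx, rfl⟩
        exact ⟨x.2, map_add_le_add x.1, map_mul x.1, hx⟩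
      · rintro ⟨hC, hadd, hmul, hX⟩
        refine ⟨⟨⟨⟨s, by simpa using hC 0, hadd, fun f => ?_⟩, ?_, ?_⟩, hC⟩, hX, rfl⟩
        · rw [show -f = C (-1) * f by simp, hmul, hC]
          simp
        · simpa using hC 1
        · exact hmul
    rw [himage]
    simp only [Set.ofPred_and, Set.ofPred_forall]
    refine (isClosed_iInter fun a => ?_).inter ((isClosed_iInter fun f => isClosed_iInter fun g =>
      ?_).inter ((isClosed_iInter fun f => isClosed_iInter fun g => ?_).inter ?_))
    · exact isClosed_eq (by fun_prop) (by fun_prop)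
    · exact isClosed_le (by fun_prop) (by fun_prop)
    · exact isClosed_eq (by fun_prop) (by fun_prop)
    · exact isClosed_le (by fun_prop) (by fun_prop)
  · rintro _ ⟨x, hx, rfl⟩ f -
    exact ⟨x.nonneg f, (x.le_eval_normPoly f).trans
      (eval_normPoly_mono f (x.nonneg X) (hx.trans (le_max_left R 0)))⟩

end BerkovichLine

/-! ### Escape to infinity -/

/-- The real number `y` lies beyond the escape radius of `∑_{i<r} a_i y^{q^i} + y^{q^r}`. -/
def Escapes (q r : ℕ) (a : ℕ → ℝ) (y : ℝ) : Prop :=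
  4 < y ∧ 2 * ∑ i ∈ Finset.range r, a i * y ^ q ^ i < y ^ q ^ r

/-- Scaling $y$ by $u\ge 1$ multiplies the top term by $u^{q^r}$ and every other term by at most
that. Allowing smaller coefficients lets upper bounds stand in for the $[g_i]_\lambda$. -/
theorem Escapes.mono {q r : ℕ} (hq : 2 ≤ q) {a b : ℕ → ℝ} (hb : ∀ i, 0 ≤ b i)
    (hab : ∀ i, b i ≤ a i) {y z : ℝ} (h : Escapes q r a y) (hyz : y ≤ z) : Escapes q r b z := by
  obtain ⟨h4, hlt⟩ := h
  have hy : 0 < y := by linarith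
  refine ⟨h4.trans_le hyz, ?_⟩
  have hu : 1 ≤ z / y := (one_le_div hy).2 hyz
  have hz : z = y * (z / y) := by field_simp
  generalize z / y = u at hu hz
  subst hz
  have hle : ∑ i ∈ Finset.range r, b i * (y * u) ^ q ^ i ≤
      (∑ i ∈ Finset.range r, a i * y ^ q ^ i) * u ^ q ^ r := by
    rw [Finset.sum_mul]
    refine Finset.sum_le_sum fun i hi => ?_
    rw [mul_pow, ← mul_assoc]
    have hpow : u ^ q ^ i ≤ u ^ q ^ r :=
      pow_le_pow_right₀ hu (Nat.pow_le_pow_right (by omega) (Finset.mem_range.1 hi).le)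
    have := (hb i).trans (hab i)
    have := hab i
    gcongr
  calc 2 * ∑ i ∈ Finset.range r, b i * (y * u) ^ q ^ i
      ≤ (2 * ∑ i ∈ Finset.range r, a i * y ^ q ^ i) * u ^ q ^ r := by linarith
    _ < y ^ q ^ r * u ^ q ^ r := by gcongr
    _ = (y * u) ^ q ^ r := (mul_pow _ _ _).symm

/-- At least half of the top term survives, and $y^{q^r}/2\ge y^2/2>2y$ because $y>4$. -/
theorem Escapes.two_mul_le {q r : ℕ} (hq : 2 ≤ q) (hr : 1 ≤ r) {a : ℕ → ℝ} {y z : ℝ}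
    (h : Escapes q r a y) (hz : y ^ q ^ r ≤ z + ∑ i ∈ Finset.range r, a i * y ^ q ^ i) :
    2 * y ≤ z := by
  obtain ⟨h4, hlt⟩ := h
  have h2 : y ^ 2 ≤ y ^ q ^ r :=
    pow_le_pow_right₀ (by linarith) (hq.trans (Nat.le_self_pow (by omega) q))
  nlinarith

/-- For $y\ge 1$ each lower power is at most $y^{q^r-1}$. The resulting threshold depends only on
the coefficients, hence is the same for all $n$ along an orbit. -/
theorem escapes_of_lt {q r : ℕ} (hq : 2 ≤ q) {a : ℕ → ℝ} (ha : ∀ i, 0 ≤ a i) {y : ℝ}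
    (hy : 4 + 2 * ∑ i ∈ Finset.range r, a i < y) : Escapes q r a y := by
  have hs : 0 ≤ ∑ i ∈ Finset.range r, a i := Finset.sum_nonneg fun i _ => ha i
  have hy1 : 1 ≤ y := by linarith
  refine ⟨by linarith, ?_⟩
  have hle : ∑ i ∈ Finset.range r, a i * y ^ q ^ i ≤
      (∑ i ∈ Finset.range r, a i) * y ^ (q ^ r - 1) := by
    rw [Finset.sum_mul]
    refine Finset.sum_le_sum fun i hi => mul_le_mul_of_nonneg_left (pow_le_pow_right₀ hy1 ?_) (ha i)
    have : q ^ i < q ^ r := Nat.pow_lt_pow_right (by omega) (Finset.mem_range.1 hi)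
    omega
  have hpos : 0 < y ^ (q ^ r - 1) := by positivity
  calc 2 * ∑ i ∈ Finset.range r, a i * y ^ q ^ i
      ≤ (2 * ∑ i ∈ Finset.range r, a i) * y ^ (q ^ r - 1) := by linarith
    _ < y * y ^ (q ^ r - 1) := by gcongr; linarith
    _ = y ^ q ^ r := mul_pow_sub_one (pow_pos (by omega) r).ne' y

section Iteration

variable {F : Type*} [NormedField F] {q r : ℕ} {G f : ℕ → F[X]}

theorem not_bddAbove_iff_exists_escapes (hq : 2 ≤ q) (hr : 1 ≤ r)
    (hf : ∀ n, f (n + 1) = ∑ i ∈ Finset.range r, G i * f n ^ q ^ i + f n ^ q ^ r)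
    (x : BerkovichLine F) :
    ¬ BddAbove (Set.range fun n => x.1 (f n)) ↔
      ∃ n, Escapes q r (fun i => x.1 (G i)) (x.1 (f n)) := by
  constructor
  · intro h
    rw [not_bddAbove_iff] at h
    obtain ⟨_, ⟨n, rfl⟩, hn⟩ := h (4 + 2 * ∑ i ∈ Finset.range r, x.1 (G i))
    exact ⟨n, escapes_of_lt hq (fun i => x.nonneg _) hn⟩
  · rintro ⟨n, hn⟩
    have step : ∀ m, Escapes q r (fun i => x.1 (G i)) (x.1 (f m)) →
        2 * x.1 (f m) ≤ x.1 (f (m + 1)) := by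
      refine fun m hm => hm.two_mul_le hq hr ?_
      have h := map_sub_le_add x.1 (f (m + 1)) (∑ i ∈ Finset.range r, G i * f m ^ q ^ i)
      rw [hf m, add_sub_cancel_left, x.apply_pow, ← hf m] at h
      refine h.trans (add_le_add_right ((x.apply_sum_le _ _).trans_eq ?_) _)
      exact Finset.sum_congr rfl fun i _ => by rw [map_mul, x.apply_pow]
    have key : ∀ k, Escapes q r (fun i => x.1 (G i)) (x.1 (f (n + k))) ∧
        2 ^ k ≤ x.1 (f (n + k)) := by
      intro k
      induction k with
      | zero => exact ⟨hn, by have := hn.1; norm_num; linarith⟩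
      | succ k ih =>
        have h := step _ ih.1
        refine ⟨ih.1.mono hq (fun i => x.nonneg _) (fun i => le_rfl) ?_, ?_⟩
        · have := x.nonneg (f (n + k))
          rw [← add_assoc]; linarith
        · rw [← add_assoc, pow_succ]; linarith [ih.2]
    rintro ⟨B, hB⟩
    obtain ⟨k, hk⟩ := pow_unbounded_of_one_lt B (one_lt_two (α := ℝ))
    exact absurd (hB ⟨n + k, rfl⟩) (not_le.2 (hk.trans_le (key k).2))

theorem isClosed_setOf_bddAbove (hq : 2 ≤ q) (hr : 1 ≤ r)
    (hf : ∀ n, f (n + 1) = ∑ i ∈ Finset.range r, G i * f n ^ q ^ i + f n ^ q ^ r) :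
    IsClosed {x : BerkovichLine F | BddAbove (Set.range fun n => x.1 (f n))} := by
  rw [← isOpen_compl_iff]
  have : {x : BerkovichLine F | BddAbove (Set.range fun n => x.1 (f n))}ᶜ =
      ⋃ n, {x | Escapes q r (fun i => x.1 (G i)) (x.1 (f n))} := by
    ext x
    simpa using not_bddAbove_iff_exists_escapes hq hr hf x
  rw [this]
  refine isOpen_iUnion fun n => ?_
  have hc := fun p : F[X] => BerkovichLine.continuous_eval p
  exact (isOpen_lt continuous_const (hc _)).inter (isOpen_lt (continuous_const.mul
    (continuous_finsetSum _ fun i _ => (hc _).mul ((hc _).pow _))) ((hc _).pow _))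

open BerkovichLine Filter in
/-- Near infinity, every point of the Berkovich line escapes already at the initial value. -/
theorem exists_escapes_of_lt (hq : 2 ≤ q) {c : F[X]} (hc : 0 < c.natDegree)
    (hdeg : ∀ i < r, (G i).natDegree + c.natDegree * q ^ i < c.natDegree * q ^ r) :
    ∃ R : ℝ, ∀ x : BerkovichLine F, R < x.1 X →
      Escapes q r (fun i => x.1 (G i)) (x.1 c) := by
  obtain ⟨hL, hlead⟩ := degree_lowerPoly hc
  have hLn : (lowerPoly c).natDegree = c.natDegree := natDegree_eq_of_degree_eq_some hL
  have hpos : 0 < (lowerPoly c).leadingCoeff := by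
    rw [hlead, norm_pos_iff, leadingCoeff_ne_zero]
    rintro rfl
    simp at hc
  have hL0 : lowerPoly c ≠ 0 := leadingCoeff_ne_zero.1 hpos.ne'
  have htop := tendsto_atTop_of_leadingCoeff_nonneg (lowerPoly c)
    (by rw [hL]; exact_mod_cast hc) hpos.le
  -- With $[\mathbf c]$ bounded below and $[g_i]$ bounded above by real polynomials in $[T]$, escape
  -- becomes a comparison of degrees.
  have hdeg' : (C 2 * ∑ i ∈ Finset.range r, normPoly (G i) * lowerPoly c ^ q ^ i).degree <
      (lowerPoly c ^ q ^ r).degree := by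
    rw [degree_C_mul two_ne_zero, degree_eq_natDegree (pow_ne_zero _ hL0), natDegree_pow, hLn]
    refine (degree_sum_le _ _).trans_lt ((Finset.sup_lt_iff ?_).2 fun i hi => ?_)
    · exact WithBot.bot_lt_coe _
    · have h1 := natDegree_normPoly_le (G i)
      have h2 := hdeg i (Finset.mem_range.1 hi)
      have h3 : (normPoly (G i) * lowerPoly c ^ q ^ i).natDegree ≤
          (G i).natDegree + c.natDegree * q ^ i := by
        refine natDegree_mul_le.trans (add_le_add h1 ?_)
        rw [natDegree_pow, hLn, mul_comm]
      refine degree_le_natDegree.trans_lt (Nat.cast_lt.2 ?_)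
      rw [mul_comm (q ^ r)]
      exact h3.trans_lt h2
  have hlim := div_tendsto_atTop_zero_of_degree_lt _ _ hdeg'
  obtain ⟨R, hR⟩ := eventually_atTop.1
    ((htop.eventually_gt_atTop 4).and (hlim.eventually_lt_const one_pos))
  refine ⟨R, fun x hx => ?_⟩
  obtain ⟨h4, hlt⟩ := hR _ hx.le
  have hE : Escapes q r (fun i => (normPoly (G i)).eval (x.1 X))
      ((lowerPoly c).eval (x.1 X)) := by
    refine ⟨h4, ?_⟩
    rw [Polynomial.eval_pow, div_lt_one (by have : (0:ℝ) < 4 := four_pos; positivity)] at hlt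
    simpa [eval_finsetSum] using hlt
  exact hE.mono hq (fun i => x.nonneg _) (fun i => x.le_eval_normPoly _) (x.eval_lowerPoly_le c)

theorem isCompact_setOf_bddAbove (hq : 2 ≤ q) (hr : 1 ≤ r)
    (hf : ∀ n, f (n + 1) = ∑ i ∈ Finset.range r, G i * f n ^ q ^ i + f n ^ q ^ r)
    (hc : 0 < (f 0).natDegree)
    (hdeg : ∀ i < r, (G i).natDegree + (f 0).natDegree * q ^ i < (f 0).natDegree * q ^ r) :
    IsCompact {x : BerkovichLine F | BddAbove (Set.range fun n => x.1 (f n))} := by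
  obtain ⟨R, hR⟩ := exists_escapes_of_lt hq hc hdeg
  refine (BerkovichLine.isCompact_disc R).of_isClosed_subset (isClosed_setOf_bddAbove hq hr hf) ?_
  intro x hx
  by_contra h
  exact (not_bddAbove_iff_exists_escapes hq hr hf x).2 ⟨0, hR x (not_le.1 h)⟩ hx

end Iteration

section Drinfeld

variable {K : Type*} [Field K] (Fq : Type*) [Field Fq] [Fintype Fq] [Algebra Fq K]

theorem orbitPoly_zero (r : ℕ) (g : ℕ → K[X]) (c : K[X]) : orbitPoly Fq r g c 0 = c := by
  simp [orbitPoly]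

theorem orbitPoly_succ (r : ℕ) (g : ℕ → K[X]) (c : K[X]) (n : ℕ) :
    orbitPoly Fq r g c (n + 1) =
      ∑ i ∈ Finset.range r, g i * orbitPoly Fq r g c n ^ (Fintype.card Fq ^ i) +
        orbitPoly Fq r g c n ^ (Fintype.card Fq ^ r) := by
  rw [orbitPoly, pow_succ', map_mul, Module.End.mul_apply, drinfeld_X_apply]
  rfl

end Drinfeld

end DrinfeldMandelbrot

end

open DrinfeldMandelbrot in
theorem proposition4p2 {Fq K : Type*} [Field Fq] [Fintype Fq] [Field K] [Algebra Fq K]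
    (t : K) (ht : Transcendental Fq t)
    (r : ℕ) (hr : 1 ≤ r)
    (g : ℕ → Polynomial K) (hg0 : g 0 = Polynomial.C t)
    (c : Polynomial K)
    (hdeg : ∀ i < r, ((g i).natDegree : ℝ) /
      ((Fintype.card Fq : ℝ) ^ r - (Fintype.card Fq : ℝ) ^ i) < (c.natDegree : ℝ))
    (v : Place K) :
    IsCompact (mandelbrot Fq v r g c) := by
  have hq : 2 ≤ Fintype.card Fq := Fintype.one_lt_card
  refine isCompact_setOf_bddAbove (G := fun i => (g i).map (toCv v)) hq hr (fun n => ?_) ?_ ?_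
  · rw [orbitPoly_succ]
    simp [Polynomial.map_sum]
  -- The case $i=0$, where $g_0=t$ is constant, forces $\deg\mathbf c>0$.
  · have h := hdeg 0 hr
    rw [hg0, Polynomial.natDegree_C, Nat.cast_zero, zero_div] at h
    rw [orbitPoly_zero, Polynomial.natDegree_map]
    exact_mod_cast h
  · intro i hi
    have hlt : (Fintype.card Fq : ℝ) ^ i < (Fintype.card Fq : ℝ) ^ r :=
      pow_lt_pow_right₀ (by exact_mod_cast hq) hi
    have h := (div_lt_iff₀ (sub_pos.2 hlt)).1 (hdeg i hi)
    rw [orbitPoly_zero, Polynomial.natDegree_map, Polynomial.natDegree_map]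
    have h' : ((g i).natDegree : ℝ) + c.natDegree * (Fintype.card Fq : ℝ) ^ i <
        c.natDegree * (Fintype.card Fq : ℝ) ^ r := by linarith
    exact_mod_cast h'
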